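/- Let $q:\mathbb{R}^n\to\mathbb{R}^n$ have a fixed point $x_*$ at which $q$ is (Fréchet) differentiable, and suppose that the Jacobian $W=\nabla q(x_*)$ is symmetric with $\|W\|<1$ (operator norm for the Euclidean norm) and that its largest and smallest eigenvalues $\lambda_{\max},\lambda_{\min}$ satisfy $\lambda_{\max}\neq-\lambda_{\min}$. Put $$w_0=\sup_{a\ge 0}\ \sin\left[\sin^{-1}\left(\frac{|\lambda_{\max}-\lambda_{\min}|\,a}{\sqrt{4+(2-\lambda_{\max}-\lambda_{\min})^2a^2}}\right)+\left|\tan^{-1}(a)-\tan^{-1}\left(\left(1-\tfrac{\lambda_{\max}+\lambda_{\min}}{2}\right)a\right)\right|\right].$$ For $m\ge 1$ and $C_0>0$, modified Anderson acceleration AA($m$) generates, from an initial point $x^{(0)}$, a sequence with $x^{(1)}=q(x^{(0)})$ and, for $k\ge 1$ and $m_k=\min(m,k)$, $x^{(k+1)}=\sum_{j=k-m_k}^{k}\alpha_j^{(k)}q(x^{(j)})$, where $(\alpha_j^{(k)})_j$ is any minimizer of $\left\|\sum_{j=k-m_k}^{k}\alpha_j\,(q(x^{(j)})-x^{(j)})\right\|$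 (Euclidean norm) subject to $\sum_{j}\alpha_j=1$ and $|\alpha_j|\le C_0$ for all $j$. Then $w_0<\|W\|$, and there is a constant $C_0'$ such that for every $m\ge1$ and every $C_0>C_0'$ there is $\delta>0$ with the following property: every sequence $(x^{(k)})$ generated by modified AA($m$) with bound $C_0$ and with $\|x^{(1)}-x_*\|<\delta$ converges to $x_*$, and its $r$-linear convergence factor satisfies $$\limsup_{k\to\infty}\|x_*-x^{(k)}\|^{1/k}\le\sqrt{w_0\,\|W\|}.$$ -/

import Mathlib

open Filter Topology

noncomputable section

/-- The largest eigenvalue of a linear operator on `ℝⁿ` (used for symmetric operators, which have a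
finite set of eigenvalues, nonempty when `n ≥ 1`). -/
def lambdaMax {n : ℕ} (W : EuclideanSpace ℝ (Fin n) →L[ℝ] EuclideanSpace ℝ (Fin n)) : ℝ :=
  sSup {μ : ℝ | Module.End.HasEigenvalue
    (W : EuclideanSpace ℝ (Fin n) →ₗ[ℝ] EuclideanSpace ℝ (Fin n)) μ}

/-- The smallest eigenvalue of a linear operator on `ℝⁿ` (used for symmetric operators). -/
def lambdaMin {n : ℕ} (W : EuclideanSpace ℝ (Fin n) →L[ℝ] EuclideanSpace ℝ (Fin n)) : ℝ :=
  sInf {μ : ℝ | Module.End.HasEigenvalue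
    (W : EuclideanSpace ℝ (Fin n) →ₗ[ℝ] EuclideanSpace ℝ (Fin n)) μ}

/-- The expression whose supremum over `a ≥ 0` is `w₀`, with `lmax`, `lmin` the extreme
eigenvalues. -/
def w0Fun (lmax lmin a : ℝ) : ℝ :=
  Real.sin (Real.arcsin (|lmax - lmin| * a / Real.sqrt (4 + (2 - lmax - lmin) ^ 2 * a ^ 2))
    + |Real.arctan a - Real.arctan ((1 - (lmax + lmin) / 2) * a)|)

/-- The constant `w₀` of a symmetric operator. The supremum is over a nonempty set which is bounded
by `1`. -/
def w0 {n : ℕ} (W : EuclideanSpace ℝ (Fin n) →L[ℝ] EuclideanSpace ℝ (Fin n)) : ℝ :=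
  sSup (w0Fun (lambdaMax W) (lambdaMin W) '' Set.Ici 0)

/-- The indices `k - m_k, …, k` used in step `k` of AA(m), where `m_k = min m k`. -/
def aaWindow (m k : ℕ) : Finset ℕ := Finset.Icc (k - min m k) k

/-- The admissible coefficients in step `k` of modified AA(m): they sum to `1` and are bounded
by `C₀` in absolute value. Only the values of `α` on the window matter. -/
def aaFeasible (m : ℕ) (C₀ : ℝ) (k : ℕ) : Set (ℕ → ℝ) :=
  {α | ∑ j ∈ aaWindow m k, α j = 1 ∧ ∀ j ∈ aaWindow m k, |α j| ≤ C₀}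

/-- The objective minimized in step `k`: the Euclidean norm of the combined residual. -/
def aaObjective {n : ℕ} (q : EuclideanSpace ℝ (Fin n) → EuclideanSpace ℝ (Fin n)) (m : ℕ)
    (x : ℕ → EuclideanSpace ℝ (Fin n)) (k : ℕ) (α : ℕ → ℝ) : ℝ :=
  ‖∑ j ∈ aaWindow m k, α j • (q (x j) - x j)‖

/-- `x` is a sequence generated by modified AA(m) with coefficient bound `C₀` applied to `q`:
`x 1 = q (x 0)`, and for every `k ≥ 1` the iterate `x (k + 1)` is obtained from some minimizer of
the constrained least-squares problem (the minimizer need not be unique). -/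
structure IsModifiedAA {n : ℕ} (q : EuclideanSpace ℝ (Fin n) → EuclideanSpace ℝ (Fin n)) (m : ℕ)
    (C₀ : ℝ) (x : ℕ → EuclideanSpace ℝ (Fin n)) : Prop where
  first : x 1 = q (x 0)
  step : ∀ k : ℕ, 1 ≤ k → ∃ α : ℕ → ℝ,
    α ∈ aaFeasible m C₀ k ∧ IsMinOn (aaObjective q m x k) (aaFeasible m C₀ k) α ∧
      x (k + 1) = ∑ j ∈ aaWindow m k, α j • q (x j)

/-- The r-linear convergence factor of a sequence that converges to `xs`. (For a convergent
sequence the real-valued limsup is that of a bounded sequence.) -/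
def rLinearFactor {n : ℕ} (x : ℕ → EuclideanSpace ℝ (Fin n)) (xs : EuclideanSpace ℝ (Fin n)) : ℝ :=
  limsup (fun k : ℕ => ‖xs - x k‖ ^ (1 / (k : ℝ))) atTop

end

/-! Let `c` and `d` be the center and half-width of the spectrum of `W`, so that `‖W v - c • v‖ ≤ d
* ‖v‖`. Write `r` for the residual at step `k` and `g` for the minimal combined residual. The next
residual is `W g` up to linearization error, and minimality of `g` gives `0 ≤ inner g (r - g)`
(`inner_combined_residual_nonneg`). The next minimization may combine `r` with `h = W g`. The
distance from `0` to the line through `r` and `h` is `‖r‖ * sin (angle r (r - h))`, and planar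
geometry bounds the sine by `w0 W` (`sin_angle_sub_le`). One more application of `W` yields
`‖r_{k+2}‖ ≤ w0 W * ‖W‖ * ‖r_k‖` plus small terms (`norm_residual_add_two_le`); the square root in
the rate comes from this two-step contraction. The small terms are `ε` times the largest residual in
a window of bounded length, so they do not change the asymptotic rate
(`geometric_bound_of_recurrence`). Strictness `w0 W < ‖W‖` holds because `c ≠ 0`
(`exists_lt_forall_sin_le`). -/

/-! ### Trigonometry of the function under the supremum -/

/-- The largest angle at which a perturbation of relative size `d` can rotate the vector with
tangential component `1` and normal component `(1 - c) * a`. -/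
noncomputable def perturbAngle (c d a : ℝ) : ℝ :=
  Real.arcsin (d * a / √(1 + ((1 - c) * a) ^ 2))

/-- The angle between the planar vectors `(1, a)` and `(1, (1 - c) * a)`. -/
noncomputable def shiftAngle (c a : ℝ) : ℝ :=
  |Real.arctan a - Real.arctan ((1 - c) * a)|

lemma perturbAngle_nonneg {c d a : ℝ} (hd : 0 ≤ d) (ha : 0 ≤ a) : 0 ≤ perturbAngle c d a :=
  Real.arcsin_nonneg.2 (by positivity)

lemma shiftAngle_nonneg (c a : ℝ) : 0 ≤ shiftAngle c a := abs_nonneg _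

lemma abs_mul_le_sqrt_one_add_sq {d e a : ℝ} (hd : 0 ≤ d) (hde : d ≤ e) (ha : 0 ≤ a) :
    d * a ≤ √(1 + (e * a) ^ 2) := by
  apply Real.le_sqrt_of_sq_le
  have : d * a ≤ e * a := by gcongr
  nlinarith [mul_nonneg hd ha]

lemma sin_perturbAngle {c d a : ℝ} (hd : 0 ≤ d) (hcd : d ≤ 1 - c) (ha : 0 ≤ a) :
    Real.sin (perturbAngle c d a) = d * a / √(1 + ((1 - c) * a) ^ 2) := by
  have h : 0 < √(1 + ((1 - c) * a) ^ 2) := by positivity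
  apply Real.sin_arcsin
  · have : 0 ≤ d * a / √(1 + ((1 - c) * a) ^ 2) := by positivity
    linarith
  · rw [div_le_one h]
    exact abs_mul_le_sqrt_one_add_sq hd hcd ha

lemma cos_perturbAngle (c d a : ℝ) :
    Real.cos (perturbAngle c d a) =
      √(1 + ((1 - c) * a) ^ 2 - (d * a) ^ 2) / √(1 + ((1 - c) * a) ^ 2) := by
  have h : 0 < 1 + ((1 - c) * a) ^ 2 := by positivity
  rw [perturbAngle, Real.cos_arcsin, ← Real.sqrt_div' _ h.le, div_pow, Real.sq_sqrt h.le]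
  congr 1
  field_simp

lemma cos_shiftAngle (c a : ℝ) :
    Real.cos (shiftAngle c a) =
      (1 + (1 - c) * a ^ 2) / (√(1 + a ^ 2) * √(1 + ((1 - c) * a) ^ 2)) := by
  rw [shiftAngle, Real.cos_abs, Real.cos_sub, Real.cos_arctan, Real.cos_arctan, Real.sin_arctan,
    Real.sin_arctan]
  field_simp

lemma shiftAngle_lt {c a : ℝ} (hc : c ≤ 1) (ha : 0 ≤ a) : shiftAngle c a < Real.pi / 2 := by
  have h1 : 0 ≤ Real.arctan a := Real.arctan_nonneg.2 ha
  have h2 : 0 ≤ Real.arctan ((1 - c) * a) :=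
    Real.arctan_nonneg.2 (mul_nonneg (by linarith) ha)
  have h3 := Real.arctan_lt_pi_div_two a
  have h4 := Real.arctan_lt_pi_div_two ((1 - c) * a)
  rw [shiftAngle, abs_lt]
  constructor <;> linarith

lemma sin_shiftAngle {c a : ℝ} (hc : c ≤ 1) (ha : 0 ≤ a) :
    Real.sin (shiftAngle c a) =
      |c| * a / (√(1 + a ^ 2) * √(1 + ((1 - c) * a) ^ 2)) := by
  have hlt := shiftAngle_lt hc ha
  rw [shiftAngle] at hlt ⊢
  rw [← Real.abs_sin_eq_sin_abs_of_abs_le_pi (by linarith [Real.pi_pos]), Real.sin_sub,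
    Real.cos_arctan, Real.cos_arctan, Real.sin_arctan, Real.sin_arctan]
  have : a / √(1 + a ^ 2) * (1 / √(1 + ((1 - c) * a) ^ 2)) -
      1 / √(1 + a ^ 2) * ((1 - c) * a / √(1 + ((1 - c) * a) ^ 2)) =
      c * a / (√(1 + a ^ 2) * √(1 + ((1 - c) * a) ^ 2)) := by
    field_simp
    ring
  rw [this, abs_div, abs_mul, abs_of_nonneg ha,
    abs_of_nonneg (a := √(1 + a ^ 2) * √(1 + ((1 - c) * a) ^ 2)) (by positivity)]

/-- Keeps the total angle where sine is increasing, so that angle bounds turn into sine bounds. It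
amounts to `sin perturbAngle ≤ cos shiftAngle`. -/
lemma perturbAngle_add_shiftAngle_le {c d a : ℝ} (hd : 0 ≤ d) (hcd : |c| + d < 1) (ha : 0 ≤ a) :
    perturbAngle c d a + shiftAngle c a ≤ Real.pi / 2 := by
  have hc := abs_le.1 (show |c| ≤ 1 - d by linarith)
  have h0 := shiftAngle_nonneg c a
  have h1 := shiftAngle_lt (c := c) (by linarith) ha
  suffices perturbAngle c d a ≤ Real.pi / 2 - shiftAngle c a by linarith
  rw [perturbAngle, ← Real.arcsin_sin (x := Real.pi / 2 - shiftAngle c a) (by linarith)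
    (by linarith), Real.sin_pi_div_two_sub, cos_shiftAngle]
  apply Real.monotone_arcsin
  rw [div_le_div_iff₀ (by positivity) (by positivity)]
  have h2 : d * a * √(1 + a ^ 2) ≤ 1 + (1 - c) * a ^ 2 := by
    have hd1 : d ≤ 1 - c := by linarith
    have h3 : √(1 + a ^ 2) ≤ 1 + a := by
      apply Real.sqrt_le_iff.2 ⟨by positivity, by nlinarith⟩
    apply abs_le_of_sq_le_sq' _ (by nlinarith [mul_nonneg (sub_nonneg.2 hd1) (sq_nonneg a)]) |>.2
    rw [mul_pow, Real.sq_sqrt (by positivity)]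
    have : (d * a) ^ 2 ≤ ((1 - c) * a) ^ 2 := by gcongr
    have : d ^ 2 ≤ d := by nlinarith
    have : d ^ 2 * a ^ 2 ≤ (1 - c) * a ^ 2 := by gcongr; linarith
    nlinarith
  calc d * a * (√(1 + a ^ 2) * √(1 + ((1 - c) * a) ^ 2))
      = (d * a * √(1 + a ^ 2)) * √(1 + ((1 - c) * a) ^ 2) := by ring
    _ ≤ _ := by gcongr

lemma w0Fun_eq {u v : ℝ} (h : v ≤ u) (a : ℝ) :
    w0Fun u v a = Real.sin (perturbAngle ((u + v) / 2) ((u - v) / 2) a +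
      shiftAngle ((u + v) / 2) a) := by
  have : √(4 + (2 - u - v) ^ 2 * a ^ 2) = 2 * √(1 + ((1 - (u + v) / 2) * a) ^ 2) := by
    rw [show 4 + (2 - u - v) ^ 2 * a ^ 2 = 2 ^ 2 * (1 + ((1 - (u + v) / 2) * a) ^ 2) by ring,
      Real.sqrt_mul (by positivity), Real.sqrt_sq (by norm_num)]
  rw [w0Fun, perturbAngle, shiftAngle, this, abs_of_nonneg (sub_nonneg.2 h)]
  have h2 : (u - v) * a / (2 * √(1 + ((1 - (u + v) / 2) * a) ^ 2)) =
      (u - v) / 2 * a / √(1 + ((1 - (u + v) / 2) * a) ^ 2) := by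
    field_simp
  rw [h2]

/-- The slope `(1 - c / b) * a` lies between `(1 - c) * a` and `a`. -/
lemma shiftAngle_div_le {c a b : ℝ} (ha : 0 ≤ a) (hb : 1 ≤ b) :
    shiftAngle (c / b) a ≤ shiftAngle c a := by
  rcases le_total 0 c with hc | hc
  · have h1 : 0 ≤ c / b := by positivity
    have h2 : c / b ≤ c := div_le_self hc hb
    have h3 : (1 - c / b) * a ≤ a := by nlinarith
    have h4 : (1 - c) * a ≤ (1 - c / b) * a := by gcongr
    have h3' := Real.arctan_mono h3
    have h4' := Real.arctan_mono h4
    rw [shiftAngle, shiftAngle, abs_of_nonneg (by linarith), abs_of_nonneg (by linarith)]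
    linarith
  · have h1 : c / b ≤ 0 := div_nonpos_of_nonpos_of_nonneg hc (by linarith)
    have h2 : c ≤ c / b := by
      rw [le_div_iff₀ (by linarith)]
      nlinarith
    have h3 : a ≤ (1 - c / b) * a := by nlinarith
    have h4 : (1 - c / b) * a ≤ (1 - c) * a := by gcongr
    have h3' := Real.arctan_mono h3
    have h4' := Real.arctan_mono h4
    rw [shiftAngle, shiftAngle, abs_of_nonpos (by linarith), abs_of_nonpos (by linarith)]
    linarith

lemma perturbAngle_div_le {c d a b : ℝ} (hd : 0 ≤ d) (hc : c ≤ 1) (ha : 0 ≤ a) (hb : 1 ≤ b) :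
    perturbAngle (c / b) (d / b) a ≤ perturbAngle c d a := by
  have hb0 : 0 < b := by linarith
  -- After clearing `b`, the denominator increases with `b`, since `c ≤ 1 ≤ b`.
  have : d / b * a / √(1 + ((1 - c / b) * a) ^ 2) = d * a / √(b ^ 2 + ((b - c) * a) ^ 2) := by
    rw [show b ^ 2 + ((b - c) * a) ^ 2 = b ^ 2 * (1 + ((1 - c / b) * a) ^ 2) by field_simp,
      Real.sqrt_mul (by positivity), Real.sqrt_sq hb0.le]
    field_simp
  rw [perturbAngle, perturbAngle, this]
  apply Real.monotone_arcsin
  have h1 : 0 ≤ 1 - c := by linarith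
  gcongr
  nlinarith

/-- The bound at `(c, d)` dominates the bound at `(c / b, d / b)`. -/
lemma sin_perturbAngle_add_shiftAngle_div_le {c d a b : ℝ} (hd : 0 ≤ d) (hcd : |c| + d < 1)
    (ha : 0 ≤ a) (hb : 1 ≤ b) :
    Real.sin (perturbAngle (c / b) (d / b) a + shiftAngle (c / b) a) ≤
      Real.sin (perturbAngle c d a + shiftAngle c a) := by
  have h1 := shiftAngle_div_le (c := c) ha hb
  have h2 := perturbAngle_div_le (c := c) hd (by linarith [le_abs_self c]) ha hb
  have h3 := shiftAngle_nonneg (c / b) a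
  have h4 : 0 ≤ perturbAngle (c / b) (d / b) a :=
    perturbAngle_nonneg (div_nonneg hd (by linarith)) ha
  apply Real.sin_le_sin_of_le_of_le_pi_div_two (by linarith [Real.pi_pos])
    (perturbAngle_add_shiftAngle_le hd hcd ha) (by linarith)

lemma sin_perturbAngle_add_shiftAngle {c d a : ℝ} (hd : 0 ≤ d) (hcd : |c| + d < 1)
    (ha : 0 ≤ a) :
    Real.sin (perturbAngle c d a + shiftAngle c a) =
      a / √(1 + a ^ 2) * ((d * (1 + (1 - c) * a ^ 2) +
        |c| * √(1 + ((1 - c) * a) ^ 2 - (d * a) ^ 2)) / (1 + ((1 - c) * a) ^ 2)) := by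
  have hc := abs_le.1 (show |c| ≤ 1 - d by linarith)
  rw [Real.sin_add, sin_perturbAngle hd (by linarith) ha, cos_perturbAngle, cos_shiftAngle,
    sin_shiftAngle (by linarith) ha]
  have h : √(1 + ((1 - c) * a) ^ 2) ^ 2 = 1 + ((1 - c) * a) ^ 2 := Real.sq_sqrt (by positivity)
  have hQ : 0 < √(1 + ((1 - c) * a) ^ 2) := by positivity
  generalize √(1 + ((1 - c) * a) ^ 2 - (d * a) ^ 2) = S
  generalize √(1 + ((1 - c) * a) ^ 2) = Q at h hQ ⊢
  rw [← h]
  field_simp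

/-- The root is bounded by `√(1 + u) ≤ 1 + u / 2`. For `c ≥ 0` the coefficients of `a ^ 2` then
match exactly, which explains the constant `|c| * (1 - |c| - d) ^ 2 / 2`; for `c ≤ 0` there is room
to spare. -/
lemma sin_perturbAngle_add_shiftAngle_le {c d a : ℝ} (hd : 0 ≤ d) (hcd : |c| + d < 1)
    (ha : 0 ≤ a) :
    Real.sin (perturbAngle c d a + shiftAngle c a) ≤
      a / √(1 + a ^ 2) *
        (|c| + d - |c| * (1 - |c| - d) ^ 2 / 2 * (a ^ 2 / (1 + ((1 - c) * a) ^ 2))) := by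
  rw [sin_perturbAngle_add_shiftAngle hd hcd ha]
  have hc := abs_le.1 (show |c| ≤ 1 - d by linarith)
  gcongr
  have hQ : 0 < 1 + ((1 - c) * a) ^ 2 := by positivity
  have hs : √(1 + ((1 - c) * a) ^ 2 - (d * a) ^ 2) ≤
      1 + (((1 - c) * a) ^ 2 - (d * a) ^ 2) / 2 := by
    have : (d * a) ^ 2 ≤ ((1 - c) * a) ^ 2 := by gcongr; linarith
    exact Real.sqrt_le_iff.2 ⟨by linarith, by nlinarith⟩
  rw [div_le_iff₀ hQ]
  have h1 : (|c| + d - |c| * (1 - |c| - d) ^ 2 / 2 * (a ^ 2 / (1 + ((1 - c) * a) ^ 2))) *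
      (1 + ((1 - c) * a) ^ 2) =
      (|c| + d) * (1 + ((1 - c) * a) ^ 2) - |c| * (1 - |c| - d) ^ 2 / 2 * a ^ 2 := by
    field_simp
  rw [h1]
  have h2 : |c| * √(1 + ((1 - c) * a) ^ 2 - (d * a) ^ 2) ≤
      |c| * (1 + (((1 - c) * a) ^ 2 - (d * a) ^ 2) / 2) := by gcongr
  refine (add_le_add_right h2 _).trans ?_
  rcases le_total 0 c with h | h
  · rw [abs_of_nonneg h]
    have : 0 ≤ c * a ^ 2 := by positivity
    nlinarith
  · rw [abs_of_nonpos h] at hcd ⊢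
    have e : 0 ≤ -c * a ^ 2 := mul_nonneg (by linarith) (sq_nonneg a)
    have : 0 ≤ (-c * a ^ 2) * (((1 - c) ^ 2 + d ^ 2) / 2 + (1 - c) * d - (1 + c - d) ^ 2 / 2) := by
      apply mul_nonneg e
      nlinarith
    nlinarith

/-- A bound below `|c| + d` that is uniform in `a`. -/
lemma exists_lt_forall_sin_le {c d : ℝ} (hc0 : c ≠ 0) (hd : 0 ≤ d) (hcd : |c| + d < 1) :
    ∃ K < |c| + d, ∀ a : ℝ, 0 ≤ a →
      Real.sin (perturbAngle c d a + shiftAngle c a) ≤ K := by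
  have hc : 0 < |c| := abs_pos.2 hc0
  set κ := |c| * (1 - |c| - d) ^ 2 / 2 with hκ
  have hκ0 : 0 < κ := by
    have : 0 < 1 - |c| - d := by linarith
    positivity
  -- For `a ≤ 1` the factor `a / √(1 + a ^ 2)` gives the gain; for `a ≥ 1` the subtracted term does.
  refine ⟨max ((|c| + d) * (√2)⁻¹) (|c| + d - κ / (1 + (1 - c) ^ 2)), ?_, fun a ha => ?_⟩
  · apply max_lt
    · have : (√2)⁻¹ < 1 := inv_lt_one_of_one_lt₀ Real.one_lt_sqrt_two
      nlinarith
    · have : 0 < κ / (1 + (1 - c) ^ 2) := by positivity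
      linarith
  · refine (sin_perturbAngle_add_shiftAngle_le hd hcd ha).trans ?_
    rw [← hκ]
    have hP : 0 < √(1 + a ^ 2) := by positivity
    have hx0 : 0 ≤ a / √(1 + a ^ 2) := by positivity
    have hx1 : a / √(1 + a ^ 2) ≤ 1 := by
      rw [div_le_one hP]
      exact Real.le_sqrt_of_sq_le (by linarith)
    have ht0 : 0 ≤ κ * (a ^ 2 / (1 + ((1 - c) * a) ^ 2)) := by positivity
    rcases le_total a 1 with h | h
    · apply le_max_of_le_left
      have hx : a / √(1 + a ^ 2) ≤ (√2)⁻¹ := by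
        rw [div_le_iff₀ hP, inv_mul_eq_div, le_div_iff₀ (by positivity)]
        apply Real.le_sqrt_of_sq_le
        rw [mul_pow, Real.sq_sqrt (by norm_num)]
        nlinarith
      calc _ ≤ a / √(1 + a ^ 2) * (|c| + d) := by gcongr; linarith
        _ ≤ (√2)⁻¹ * (|c| + d) := by gcongr
        _ = _ := mul_comm _ _
    · apply le_max_of_le_right
      have ht : κ / (1 + (1 - c) ^ 2) ≤ κ * (a ^ 2 / (1 + ((1 - c) * a) ^ 2)) := by
        rw [div_eq_mul_one_div]
        gcongr κ * ?_
        rw [div_le_div_iff₀ (by positivity) (by positivity)]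
        nlinarith
      have hpos : 0 ≤ |c| + d - κ / (1 + (1 - c) ^ 2) := by
        have h5 : κ / (1 + (1 - c) ^ 2) ≤ κ := div_le_self hκ0.le (by nlinarith [sq_nonneg (1 - c)])
        have h6 : (1 - |c| - d) ^ 2 ≤ 1 := by
          apply pow_le_one₀ <;> linarith
        have h7 : κ ≤ |c| := by nlinarith
        linarith
      calc _ ≤ a / √(1 + a ^ 2) * (|c| + d - κ / (1 + (1 - c) ^ 2)) := by gcongr
        _ ≤ 1 * (|c| + d - κ / (1 + (1 - c) ^ 2)) := by gcongr
        _ = _ := one_mul _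

/-- The limit `a → ∞` of the hypothesis, needed when `r` is parallel to `g` and no finite ratio `a`
exists. -/
lemma perturbation_le_of_forall_sin_le {c d ω : ℝ} (hd : 0 ≤ d) (hcd : |c| + d < 1)
    (hω : ∀ a : ℝ, 0 ≤ a → Real.sin (perturbAngle c d a + shiftAngle c a) ≤ ω) :
    d ≤ ω * (1 - c) := by
  have hc := abs_le.1 (show |c| ≤ 1 - d by linarith)
  have key : ∀ a : ℝ, 0 ≤ a → (d - ω * (1 - c)) * a ≤ ω := by
    intro a ha
    have h1 := perturbAngle_add_shiftAngle_le hd hcd ha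
    have h2 := shiftAngle_nonneg c a
    have h3 := perturbAngle_nonneg (c := c) hd ha
    have h4 := Real.sin_le_sin_of_le_of_le_pi_div_two (x := perturbAngle c d a)
      (by linarith [Real.pi_pos]) h1 (by linarith)
    have h5 := (h4.trans (hω a ha))
    rw [sin_perturbAngle hd (by linarith) ha, div_le_iff₀ (by positivity)] at h5
    have hω0 : 0 ≤ ω := by
      by_contra! hneg
      have : 0 < √(1 + ((1 - c) * a) ^ 2) := by positivity
      nlinarith [mul_nonneg hd ha]
    have h0 : 0 ≤ (1 - c) * a := mul_nonneg (by linarith) ha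
    have h6 : √(1 + ((1 - c) * a) ^ 2) ≤ 1 + (1 - c) * a :=
      Real.sqrt_le_iff.2 ⟨by linarith, by nlinarith⟩
    nlinarith
  by_contra! h
  have hp : 0 < d - ω * (1 - c) := by linarith
  obtain ⟨N, hN⟩ := exists_nat_gt (ω / (d - ω * (1 - c)))
  rw [div_lt_iff₀ hp] at hN
  have := key N N.cast_nonneg
  linarith

/-! ### Angles between residuals -/

section Geometry

open InnerProductGeometry

variable {V : Type*} [NormedAddCommGroup V] [InnerProductSpace ℝ V]

/-- The left side is the distance from `x` to the line spanned by `y`. -/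
lemma norm_mul_sin_angle_le (x y : V) (hy : y ≠ 0) :
    ‖x‖ * Real.sin (angle x y) ≤ ‖x - y‖ := by
  have hy' : 0 < ‖y‖ := norm_pos_iff.2 hy
  have h := sin_angle_mul_norm_mul_norm x y
  have h1 : √(inner ℝ x x * inner ℝ y y - inner ℝ x y * inner ℝ x y) ≤ ‖x - y‖ * ‖y‖ := by
    apply Real.sqrt_le_iff.2 ⟨by positivity, ?_⟩
    rw [mul_pow, norm_sub_sq_real, real_inner_self_eq_norm_sq, real_inner_self_eq_norm_sq]
    nlinarith [sq_nonneg (inner ℝ x y - ‖y‖ ^ 2)]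
  rw [← h] at h1
  refine le_of_mul_le_mul_right ?_ hy'
  linarith

/-- The extreme direction is tangent to the ball of radius `ρ` around `p`. -/
lemma angle_sub_le_arcsin {p z : V} {ρ : ℝ} (hz : ‖z‖ ≤ ρ) (hρ : ρ < ‖p‖) :
    angle p (p - z) ≤ Real.arcsin (ρ / ‖p‖) := by
  have hp : 0 < ‖p‖ := (norm_nonneg z).trans_lt (hz.trans_lt hρ)
  have hin : 0 < inner ℝ p (p - z) := by
    rw [inner_sub_right, real_inner_self_eq_norm_sq]
    have := real_inner_le_norm p z
    have : ‖p‖ * ‖z‖ ≤ ‖p‖ * ρ := by gcongr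
    nlinarith
  have hy : p - z ≠ 0 := by
    intro h
    rw [h, inner_zero_right] at hin
    exact hin.false
  have hle : angle p (p - z) ≤ Real.pi / 2 := by
    rw [angle, Real.arccos_le_pi_div_two]
    positivity
  have hs := norm_mul_sin_angle_le p (p - z) hy
  rw [sub_sub_cancel] at hs
  rw [← Real.arcsin_sin (by linarith [angle_nonneg p (p - z), Real.pi_pos]) hle]
  apply Real.monotone_arcsin
  rw [le_div_iff₀ hp]
  linarith

lemma norm_smul_add_eq_of_inner_eq_zero {g s : V} (hgs : inner ℝ g s = 0) (hs : s ≠ 0) (t : ℝ) :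
    ‖t • g + s‖ = ‖s‖ * √(1 + (t * (‖g‖ / ‖s‖)) ^ 2) := by
  have hs' : 0 < ‖s‖ := norm_pos_iff.2 hs
  have h : ‖t • g + s‖ ^ 2 = ‖s‖ ^ 2 * (1 + (t * (‖g‖ / ‖s‖)) ^ 2) := by
    rw [norm_add_sq_real, inner_smul_left, hgs, norm_smul, mul_pow, Real.norm_eq_abs, sq_abs]
    field_simp
    ring
  rw [← Real.sqrt_sq (norm_nonneg (t • g + s)), h, Real.sqrt_mul (sq_nonneg _),
    Real.sqrt_sq hs'.le]

lemma angle_add_smul_add {g s : V} (hgs : inner ℝ g s = 0) (hs : s ≠ 0) {c : ℝ} (hc : c ≤ 1) :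
    angle (g + s) ((1 - c) • g + s) = shiftAngle c (‖g‖ / ‖s‖) := by
  have hs' : 0 < ‖s‖ := norm_pos_iff.2 hs
  have ha : 0 ≤ ‖g‖ / ‖s‖ := by positivity
  have h1 := norm_smul_add_eq_of_inner_eq_zero hgs hs 1
  rw [one_smul, one_mul] at h1
  have hin : inner ℝ (g + s) ((1 - c) • g + s) = ‖s‖ ^ 2 * (1 + (1 - c) * (‖g‖ / ‖s‖) ^ 2) := by
    rw [inner_add_left, inner_add_right, inner_add_right, inner_smul_right, inner_smul_right,
      real_inner_comm g s, hgs, real_inner_self_eq_norm_sq, real_inner_self_eq_norm_sq]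
    field_simp
    ring
  have hlt := shiftAngle_lt hc ha
  rw [← Real.arccos_cos (shiftAngle_nonneg c (‖g‖ / ‖s‖)) (by linarith [Real.pi_pos]),
    cos_shiftAngle, angle, hin, h1, norm_smul_add_eq_of_inner_eq_zero hgs hs (1 - c)]
  congr 1
  field_simp

/-- Triangle inequality for angles through `(1 - c) • g + s`: replacing `h` by `c • g` costs at most
`perturbAngle`, and the remaining planar angle is `shiftAngle`, both at `a = ‖g‖ / ‖s‖`. -/
lemma sin_angle_sub_le_of_inner_eq_zero {c d ω : ℝ} (hd : 0 ≤ d) (hcd : |c| + d < 1)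
    (hω : ∀ a : ℝ, 0 ≤ a → Real.sin (perturbAngle c d a + shiftAngle c a) ≤ ω)
    {g s h : V} (hg : g ≠ 0) (hgs : inner ℝ g s = 0) (hh : ‖h - c • g‖ ≤ d * ‖g‖) :
    Real.sin (angle (g + s) (g + s - h)) ≤ ω := by
  have hg' : 0 < ‖g‖ := norm_pos_iff.2 hg
  have hc := abs_le.1 (show |c| ≤ 1 - d by linarith)
  have hc2 := abs_le.1 (le_refl |c|)
  have hlt : d < 1 - c := by linarith
  have hy : g + s - h = ((1 - c) • g + s) - (h - c • g) := by
    rw [sub_smul, one_smul]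
    abel
  rw [hy]
  rcases eq_or_ne s 0 with rfl | hs
  · have hp : ‖(1 - c) • g‖ = (1 - c) * ‖g‖ := by
      rw [norm_smul, Real.norm_of_nonneg (by linarith)]
    have h1 : angle ((1 - c) • g) ((1 - c) • g - (h - c • g)) ≤ Real.arcsin (d / (1 - c)) := by
      have := angle_sub_le_arcsin (p := (1 - c) • g) hh (by rw [hp]; gcongr)
      rwa [hp, mul_div_mul_right _ _ hg'.ne'] at this
    rw [add_zero, add_zero]
    rw [angle_smul_left_of_pos _ _ (by linarith)] at h1
    have h2 : d / (1 - c) ≤ ω := by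
      rw [div_le_iff₀ (by linarith)]
      exact perturbation_le_of_forall_sin_le hd hcd hω
    have h3 : 0 ≤ d / (1 - c) := div_nonneg hd (by linarith)
    have h4 : d / (1 - c) ≤ 1 := (div_le_one (by linarith)).2 hlt.le
    have h5 := Real.sin_le_sin_of_le_of_le_pi_div_two
      (by linarith [Real.pi_pos, angle_nonneg g ((1 - c) • g - (h - c • g))])
      (Real.arcsin_le_pi_div_two _) h1
    rw [Real.sin_arcsin (by linarith) h4] at h5
    exact h5.trans h2
  · have hs' : 0 < ‖s‖ := norm_pos_iff.2 hs
    have ha : 0 ≤ ‖g‖ / ‖s‖ := by positivity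
    refine le_trans ?_ (hω _ ha)
    have hp := norm_smul_add_eq_of_inner_eq_zero hgs hs (1 - c)
    have hlt' : d * ‖g‖ < ‖(1 - c) • g + s‖ := by
      rw [hp, ← div_lt_iff₀' hs', mul_div_assoc]
      apply Real.lt_sqrt_of_sq_lt
      have : (d * (‖g‖ / ‖s‖)) ^ 2 ≤ ((1 - c) * (‖g‖ / ‖s‖)) ^ 2 := by gcongr
      linarith
    have h1 := angle_sub_le_arcsin hh hlt'
    have h2 : Real.arcsin (d * ‖g‖ / ‖(1 - c) • g + s‖) = perturbAngle c d (‖g‖ / ‖s‖) := by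
      rw [hp, perturbAngle, div_mul_eq_div_div, mul_div_assoc]
    rw [h2] at h1
    have h3 := angle_add_smul_add hgs hs (c := c) (by linarith)
    have h4 := angle_le_angle_add_angle (g + s) ((1 - c) • g + s)
      ((1 - c) • g + s - (h - c • g))
    rw [h3] at h4
    exact Real.sin_le_sin_of_le_of_le_pi_div_two
      (by linarith [Real.pi_pos, angle_nonneg (g + s) ((1 - c) • g + s - (h - c • g))])
      (perturbAngle_add_shiftAngle_le hd hcd ha) (by linarith)

/-- Replacing `g` by the projection `b • g` of `r` restores orthogonality and turns `(c, d)` into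
`(c / b, d / b)`. The variational inequality says `b ≥ 1`, where the bound is no worse. -/
lemma sin_angle_sub_le {c d ω : ℝ} (hd : 0 ≤ d) (hcd : |c| + d < 1)
    (hω : ∀ a : ℝ, 0 ≤ a → Real.sin (perturbAngle c d a + shiftAngle c a) ≤ ω)
    {g r h : V} (hg : g ≠ 0) (hgr : 0 ≤ inner ℝ g (r - g)) (hh : ‖h - c • g‖ ≤ d * ‖g‖) :
    Real.sin (angle r (r - h)) ≤ ω := by
  have hg' : 0 < ‖g‖ := norm_pos_iff.2 hg
  set b := inner ℝ g r / ‖g‖ ^ 2 with hb_def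
  have hb : 1 ≤ b := by
    rw [inner_sub_right, real_inner_self_eq_norm_sq] at hgr
    rw [hb_def, one_le_div (by positivity)]
    linarith
  have hb0 : 0 < b := by linarith
  have horth : inner ℝ (b • g) (r - b • g) = 0 := by
    rw [inner_smul_left, inner_sub_right, inner_smul_right, real_inner_self_eq_norm_sq, hb_def]
    field_simp
    simp
  have hcb : |c / b| + d / b < 1 := by
    rw [abs_div, abs_of_pos hb0, ← add_div, div_lt_one hb0]
    linarith
  have hh' : ‖h - (c / b) • b • g‖ ≤ d / b * ‖b • g‖ := by
    rw [smul_smul, div_mul_cancel₀ _ hb0.ne', norm_smul, Real.norm_of_nonneg hb0.le, ← mul_assoc,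
      div_mul_cancel₀ _ hb0.ne']
    exact hh
  have := sin_angle_sub_le_of_inner_eq_zero (div_nonneg hd hb0.le) hcb
    (fun a ha => (sin_perturbAngle_add_shiftAngle_div_le hd hcd ha hb).trans (hω a ha))
    (smul_ne_zero hb0.ne' hg) horth hh'
  rwa [add_sub_cancel] at this

lemma norm_sub_inner_smul_eq (x y : V) (hy : y ≠ 0) :
    ‖x - (inner ℝ x y / ‖y‖ ^ 2) • y‖ = ‖x‖ * Real.sin (angle x y) := by
  have hy' : 0 < ‖y‖ := norm_pos_iff.2 hy
  have h := sin_angle_mul_norm_mul_norm x y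
  rw [← mul_assoc, ← eq_div_iff hy'.ne'] at h
  rw [mul_comm, h, eq_div_iff hy'.ne', ← Real.sqrt_sq (norm_nonneg (x - _)),
    ← Real.sqrt_sq hy'.le, ← Real.sqrt_mul (sq_nonneg _), Real.sqrt_sq hy'.le]
  congr 1
  rw [norm_sub_sq_real, inner_smul_right, norm_smul, mul_pow, Real.norm_eq_abs, sq_abs,
    real_inner_self_eq_norm_sq, real_inner_self_eq_norm_sq]
  field_simp
  ring

/-- Affine combinations of `r` and `h` with bounded coefficients gain the factor `ω` over `r`. -/
lemma exists_norm_combination_le {c d ω : ℝ} (hd : 0 ≤ d) (hcd : |c| + d < 1)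
    (hω : ∀ a : ℝ, 0 ≤ a → Real.sin (perturbAngle c d a + shiftAngle c a) ≤ ω)
    {g r h : V} (hgr : 0 ≤ inner ℝ g (r - g)) (hh : ‖h - c • g‖ ≤ d * ‖g‖) :
    ∃ γ : ℝ, |γ| ≤ (1 - (|c| + d))⁻¹ ∧ ‖(1 - γ) • r + γ • h‖ ≤ ω * ‖r‖ := by
  have hw : 0 < 1 - (|c| + d) := by linarith
  have hw0 : 0 ≤ |c| + d := by positivity
  rcases eq_or_ne g 0 with rfl | hg
  · have hh0 : h = 0 := by simpa using hh
    have hω0 : 0 ≤ ω := by simpa [perturbAngle, shiftAngle] using hω 0 le_rfl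
    refine ⟨1, ?_, ?_⟩
    · rw [abs_one]
      exact (one_le_inv₀ hw).2 (by linarith)
    · simp only [hh0, sub_self, zero_smul, smul_zero, add_zero, norm_zero]
      positivity
  have hg' : 0 < ‖g‖ := norm_pos_iff.2 hg
  have hgr' : ‖g‖ ≤ ‖r‖ := by
    rw [inner_sub_right, real_inner_self_eq_norm_sq] at hgr
    have := real_inner_le_norm g r
    nlinarith
  have hnh : ‖h‖ ≤ (|c| + d) * ‖r‖ := by
    calc ‖h‖ = ‖(h - c • g) + c • g‖ := by rw [sub_add_cancel]
      _ ≤ d * ‖g‖ + |c| * ‖g‖ := by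
        refine (norm_add_le _ _).trans (add_le_add hh ?_)
        rw [norm_smul, Real.norm_eq_abs]
      _ = (|c| + d) * ‖g‖ := by ring
      _ ≤ _ := by gcongr
  have hy : (1 - (|c| + d)) * ‖r‖ ≤ ‖r - h‖ := by
    have := norm_sub_norm_le r h
    linarith
  have hr' : 0 < ‖r‖ := hg'.trans_le hgr'
  have hy0 : 0 < ‖r - h‖ := (by positivity : 0 < (1 - (|c| + d)) * ‖r‖).trans_le hy
  -- The coefficient of the projection of `r` onto `r - h`; it is bounded because `‖r - h‖ ≥ (1 -
  -- (|c| + d)) * ‖r‖`.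
  refine ⟨inner ℝ r (r - h) / ‖r - h‖ ^ 2, ?_, ?_⟩
  · rw [abs_div, abs_of_nonneg (sq_nonneg ‖r - h‖), div_le_iff₀ (by positivity),
      inv_mul_eq_div, le_div_iff₀ hw]
    calc |inner ℝ r (r - h)| * (1 - (|c| + d))
        ≤ ‖r‖ * ‖r - h‖ * (1 - (|c| + d)) := by
          gcongr
          exact abs_real_inner_le_norm _ _
      _ = ((1 - (|c| + d)) * ‖r‖) * ‖r - h‖ := by ring
      _ ≤ ‖r - h‖ * ‖r - h‖ := by gcongr
      _ = _ := by ring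
  · have e : ∀ γ : ℝ, (1 - γ) • r + γ • h = r - γ • (r - h) := by
      intro γ
      rw [sub_smul, one_smul, smul_sub]
      abel
    rw [e, norm_sub_inner_smul_eq _ _ (norm_pos_iff.1 hy0), mul_comm]
    gcongr
    exact sin_angle_sub_le hd hcd hω hg hgr hh

/-- The variational inequality for a minimizer of the norm along a segment. -/
lemma inner_sub_nonneg_of_forall_norm_le {g r : V}
    (h : ∀ t : ℝ, 0 ≤ t → t ≤ 1 → ‖g‖ ≤ ‖g + t • (r - g)‖) : 0 ≤ inner ℝ g (r - g) := by
  by_contra! hneg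
  set i := inner ℝ g (r - g) with hi
  have hv : r - g ≠ 0 := by
    intro h0
    rw [hi, h0, inner_zero_right] at hneg
    exact hneg.false
  have hv' : 0 < ‖r - g‖ := norm_pos_iff.2 hv
  have key : ∀ t : ℝ, 0 < t → t ≤ 1 → 0 ≤ 2 * i + t * ‖r - g‖ ^ 2 := by
    intro t ht0 ht1
    have h1 := pow_le_pow_left₀ (norm_nonneg _) (h t ht0.le ht1) 2
    rw [norm_add_sq_real, inner_smul_right, norm_smul, mul_pow, Real.norm_eq_abs, sq_abs,
      ← hi] at h1
    have : 0 ≤ t * (2 * i + t * ‖r - g‖ ^ 2) := by linarith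
    exact nonneg_of_mul_nonneg_right this ht0
  -- The minimizer of the quadratic in `t`, capped at `1`; there `2 * i + t * ‖r - g‖ ^ 2 ≤ i < 0`.
  have h2 := key (min 1 (-i / ‖r - g‖ ^ 2))
    (lt_min one_pos (div_pos (by linarith) (by positivity))) (min_le_left _ _)
  have h3 : min 1 (-i / ‖r - g‖ ^ 2) * ‖r - g‖ ^ 2 ≤ -i := by
    rw [← le_div_iff₀ (by positivity)]
    exact min_le_right _ _
  linarith

end Geometry

/-! ### Extreme eigenvalues and the constant `w0` -/

section Spectral

variable {n : ℕ} {W : EuclideanSpace ℝ (Fin n) →L[ℝ] EuclideanSpace ℝ (Fin n)}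

lemma abs_le_norm_of_hasEigenvalue {μ : ℝ} (h : Module.End.HasEigenvalue
    (W : EuclideanSpace ℝ (Fin n) →ₗ[ℝ] EuclideanSpace ℝ (Fin n)) μ) : |μ| ≤ ‖W‖ := by
  obtain ⟨v, hv⟩ := h.exists_hasEigenvector
  have h1 : W v = μ • v := hv.apply_eq_smul
  have hv0 : 0 < ‖v‖ := norm_pos_iff.2 hv.2
  have h2 := W.le_opNorm v
  rw [h1, norm_smul, Real.norm_eq_abs] at h2
  exact le_of_mul_le_mul_right h2 hv0

lemma le_lambdaMax {μ : ℝ} (h : Module.End.HasEigenvalue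
    (W : EuclideanSpace ℝ (Fin n) →ₗ[ℝ] EuclideanSpace ℝ (Fin n)) μ) : μ ≤ lambdaMax W :=
  le_csSup ⟨‖W‖, fun _ h' => (abs_le.1 (abs_le_norm_of_hasEigenvalue h')).2⟩ h

lemma lambdaMin_le {μ : ℝ} (h : Module.End.HasEigenvalue
    (W : EuclideanSpace ℝ (Fin n) →ₗ[ℝ] EuclideanSpace ℝ (Fin n)) μ) : lambdaMin W ≤ μ :=
  csInf_le ⟨-‖W‖, fun _ h' => (abs_le.1 (abs_le_norm_of_hasEigenvalue h')).1⟩ h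

lemma exists_hasEigenvalue [NeZero n]
    (hW : (W : EuclideanSpace ℝ (Fin n) →ₗ[ℝ] EuclideanSpace ℝ (Fin n)).IsSymmetric) :
    ∃ μ : ℝ, Module.End.HasEigenvalue
      (W : EuclideanSpace ℝ (Fin n) →ₗ[ℝ] EuclideanSpace ℝ (Fin n)) μ :=
  ⟨_, hW.hasEigenvalue_eigenvalues finrank_euclideanSpace_fin 0⟩

lemma lambdaMin_le_lambdaMax [NeZero n]
    (hW : (W : EuclideanSpace ℝ (Fin n) →ₗ[ℝ] EuclideanSpace ℝ (Fin n)).IsSymmetric) :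
    lambdaMin W ≤ lambdaMax W := by
  obtain ⟨μ, hμ⟩ := exists_hasEigenvalue hW
  exact (lambdaMin_le hμ).trans (le_lambdaMax hμ)

/-- The spectral radius written through the center and the half-width of the spectrum. -/
lemma abs_center_add_halfWidth_le_norm [NeZero n]
    (hW : (W : EuclideanSpace ℝ (Fin n) →ₗ[ℝ] EuclideanSpace ℝ (Fin n)).IsSymmetric) :
    |(lambdaMax W + lambdaMin W) / 2| + (lambdaMax W - lambdaMin W) / 2 ≤ ‖W‖ := by
  have h1 : lambdaMax W ≤ ‖W‖ := csSup_le (exists_hasEigenvalue hW)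
    fun _ h' => (abs_le.1 (abs_le_norm_of_hasEigenvalue h')).2
  have h2 : -‖W‖ ≤ lambdaMin W := le_csInf (exists_hasEigenvalue hW)
    fun _ h' => (abs_le.1 (abs_le_norm_of_hasEigenvalue h')).1
  suffices |(lambdaMax W + lambdaMin W) / 2| ≤ ‖W‖ - (lambdaMax W - lambdaMin W) / 2 by linarith
  rw [abs_le]
  constructor <;> linarith

/-- In an orthonormal eigenbasis, `W - c` is diagonal with entries in `[-d, d]`. -/
lemma norm_apply_sub_center_smul_le
    (hW : (W : EuclideanSpace ℝ (Fin n) →ₗ[ℝ] EuclideanSpace ℝ (Fin n)).IsSymmetric)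
    (v : EuclideanSpace ℝ (Fin n)) :
    ‖W v - ((lambdaMax W + lambdaMin W) / 2) • v‖ ≤ (lambdaMax W - lambdaMin W) / 2 * ‖v‖ := by
  rcases Nat.eq_zero_or_pos n with rfl | hn
  · simp [Subsingleton.elim v 0]
  have : NeZero n := ⟨hn.ne'⟩
  have hd : 0 ≤ (lambdaMax W - lambdaMin W) / 2 := by
    linarith [lambdaMin_le_lambdaMax hW]
  set b := hW.eigenvectorBasis finrank_euclideanSpace_fin with hb
  apply le_of_sq_le_sq _ (by positivity)
  rw [mul_pow, ← b.repr.norm_map, ← b.repr.norm_map v, EuclideanSpace.norm_sq_eq,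
    EuclideanSpace.norm_sq_eq, Finset.mul_sum]
  apply Finset.sum_le_sum
  intro i _
  have h1 : b.repr (W v) i = hW.eigenvalues finrank_euclideanSpace_fin i * b.repr v i :=
    hW.eigenvectorBasis_apply_self_apply finrank_euclideanSpace_fin v i
  have h2 : b.repr (W v - ((lambdaMax W + lambdaMin W) / 2) • v) i =
      (hW.eigenvalues finrank_euclideanSpace_fin i - (lambdaMax W + lambdaMin W) / 2) *
        b.repr v i := by
    rw [map_sub, map_smul, PiLp.sub_apply, PiLp.smul_apply, h1, smul_eq_mul, sub_mul]
  have hi := hW.hasEigenvalue_eigenvalues finrank_euclideanSpace_fin i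
  have h3 := le_lambdaMax hi
  have h4 := lambdaMin_le hi
  simp only [RCLike.ofReal_real_eq_id, id_eq] at h3 h4
  rw [h2, norm_mul, mul_pow]
  gcongr
  rw [Real.norm_eq_abs, abs_le]
  constructor <;> linarith

lemma w0Fun_le_one (u v a : ℝ) : w0Fun u v a ≤ 1 := Real.sin_le_one _

lemma sin_le_w0 [NeZero n]
    (hW : (W : EuclideanSpace ℝ (Fin n) →ₗ[ℝ] EuclideanSpace ℝ (Fin n)).IsSymmetric)
    {a : ℝ} (ha : 0 ≤ a) :
    Real.sin (perturbAngle ((lambdaMax W + lambdaMin W) / 2) ((lambdaMax W - lambdaMin W) / 2) a +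
      shiftAngle ((lambdaMax W + lambdaMin W) / 2) a) ≤ w0 W := by
  rw [← w0Fun_eq (lambdaMin_le_lambdaMax hW)]
  refine le_csSup ⟨1, ?_⟩ (Set.mem_image_of_mem _ ha)
  rintro _ ⟨b, -, rfl⟩
  exact w0Fun_le_one _ _ b

lemma w0_nonneg [NeZero n]
    (hW : (W : EuclideanSpace ℝ (Fin n) →ₗ[ℝ] EuclideanSpace ℝ (Fin n)).IsSymmetric) :
    0 ≤ w0 W := by
  simpa [perturbAngle, shiftAngle] using sin_le_w0 hW le_rfl

lemma w0_lt_norm [NeZero n]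
    (hW : (W : EuclideanSpace ℝ (Fin n) →ₗ[ℝ] EuclideanSpace ℝ (Fin n)).IsSymmetric)
    (hnorm : ‖W‖ < 1) (hne : lambdaMax W ≠ -lambdaMin W) : w0 W < ‖W‖ := by
  have h1 := abs_center_add_halfWidth_le_norm hW
  have h2 := lambdaMin_le_lambdaMax hW
  have hc : (lambdaMax W + lambdaMin W) / 2 ≠ 0 := by
    intro h
    apply hne
    linarith
  obtain ⟨K, hK, hK'⟩ := exists_lt_forall_sin_le (d := (lambdaMax W - lambdaMin W) / 2) hc
    (by linarith) (by linarith)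
  refine lt_of_le_of_lt (csSup_le (Set.image_nonempty.2 Set.nonempty_Ici) ?_) (hK.trans_le h1)
  rintro _ ⟨a, ha, rfl⟩
  rw [w0Fun_eq h2]
  exact hK' a ha

end Spectral

/-! ### Geometric decay from perturbed recurrences -/

section Sequences

/-- A perturbed two-term recurrence `R (k + 2) ≤ ρ * R k + ε * max R` yields geometric decay. The
recurrence may depend on the decay so far and on a side condition `A` that it propagates. -/
lemma geometric_bound_of_recurrence {R : ℕ → ℝ} {A : ℕ → Prop} {N m : ℕ} {ρ θ C ε : ℝ}
    (hθ0 : 0 < θ) (hθ1 : θ ≤ 1) (hC : 0 ≤ C) (hρ : 0 ≤ ρ)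
    (hbase : ∀ j, N ≤ j → j ≤ N + m + 1 → A j ∧ R j ≤ C * θ ^ j)
    (hrec : ∀ k, N + m ≤ k → (∀ j, N ≤ j → j ≤ k + 1 → A j ∧ R j ≤ C * θ ^ j) →
      A (k + 2) ∧
        ∀ M, (∀ j, k - m ≤ j → j ≤ k + 1 → R j ≤ M) → R (k + 2) ≤ ρ * R k + ε * M)
    (hρε : ρ + ε / θ ^ m ≤ θ ^ 2) :
    ∀ j, N ≤ j → A j ∧ R j ≤ C * θ ^ j := by
  intro j
  induction j using Nat.strong_induction_on with
  | _ j ih =>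
    intro hj
    rcases Nat.lt_or_ge (N + m + 1) j with h | h
    · obtain ⟨k, rfl⟩ : ∃ k, j = k + 2 := ⟨j - 2, by omega⟩
      have ih' : ∀ i, N ≤ i → i ≤ k + 1 → A i ∧ R i ≤ C * θ ^ i :=
        fun i h1 h2 => ih i (by omega) h1
      obtain ⟨hA, hR⟩ := hrec k (by omega) ih'
      refine ⟨hA, ?_⟩
      have h1 := hR (C * θ ^ (k - m)) fun i h1 h2 =>
        (ih' i (by omega) h2).2.trans
          (mul_le_mul_of_nonneg_left (pow_le_pow_of_le_one hθ0.le hθ1 h1) hC)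
      have h2 := (ih' k (by omega) (by omega)).2
      -- The oldest index of the window costs a factor `θ ^ (-m)`, whence the form of `hρε`.
      have h3 : θ ^ (k - m) = θ ^ k / θ ^ m := by
        rw [eq_div_iff (by positivity), ← pow_add, Nat.sub_add_cancel (by omega)]
      calc R (k + 2) ≤ ρ * (C * θ ^ k) + ε * (C * θ ^ (k - m)) :=
            h1.trans (add_le_add_left (mul_le_mul_of_nonneg_left h2 hρ) _)
        _ = C * θ ^ k * (ρ + ε / θ ^ m) := by
            rw [h3]
            ring
        _ ≤ C * θ ^ k * θ ^ 2 := by gcongr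
        _ = C * θ ^ (k + 2) := by ring
    · exact hbase j hj h

lemma limsup_root_le_of_eventually_le {u : ℕ → ℝ} {C θ : ℝ} (hu : ∀ k, 0 ≤ u k) (hθ : 0 < θ)
    (h : ∀ᶠ k in atTop, u k ≤ C * θ ^ k) :
    limsup (fun k : ℕ => u k ^ (1 / (k : ℝ))) atTop ≤ θ := by
  have hD : 0 < |C| + 1 := by positivity
  have hlim : Tendsto (fun k : ℕ => (|C| + 1) ^ (1 / (k : ℝ)) * θ) atTop (𝓝 θ) := by
    have h1 : Tendsto (fun k : ℕ => (|C| + 1) ^ (1 / (k : ℝ))) atTop (𝓝 ((|C| + 1) ^ (0 : ℝ))) :=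
      tendsto_const_nhds.rpow tendsto_one_div_atTop_nhds_zero_nat (Or.inl hD.ne')
    rw [Real.rpow_zero] at h1
    simpa using h1.mul_const θ
  rw [← hlim.limsup_eq]
  apply limsup_le_limsup
  · filter_upwards [h, eventually_ge_atTop 1] with k hk hk1
    have hk0 : (k : ℝ) ≠ 0 := by
      have : k ≠ 0 := by omega
      exact_mod_cast this
    calc u k ^ (1 / (k : ℝ)) ≤ ((|C| + 1) * θ ^ k) ^ (1 / (k : ℝ)) := by
          apply Real.rpow_le_rpow (hu k) _ (by positivity)
          refine hk.trans ?_
          gcongr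
          linarith [le_abs_self C]
      _ = (|C| + 1) ^ (1 / (k : ℝ)) * θ := by
          rw [Real.mul_rpow hD.le (by positivity), ← Real.rpow_natCast θ k, ← Real.rpow_mul hθ.le,
            mul_one_div_cancel hk0, Real.rpow_one]
  · exact isCoboundedUnder_le_of_le atTop (x := 0) fun k => Real.rpow_nonneg (hu k) _
  · exact hlim.isBoundedUnder_le

end Sequences

/-! ### One and two steps of the algorithm -/

section Anderson

lemma card_aaWindow_le (m k : ℕ) : (aaWindow m k).card ≤ m + 1 := by
  rw [aaWindow, Nat.card_Icc]
  omega

lemma mem_aaWindow {m k j : ℕ} : j ∈ aaWindow m k ↔ k - m ≤ j ∧ j ≤ k := by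
  rw [aaWindow, Finset.mem_Icc]
  omega

lemma norm_sum_smul_le {E : Type*} [NormedAddCommGroup E] [NormedSpace ℝ E] {m k : ℕ} {C₀ M : ℝ}
    {α : ℕ → ℝ} {f : ℕ → E} (hM : 0 ≤ M) (hC : 0 ≤ C₀) (hα : α ∈ aaFeasible m C₀ k)
    (hf : ∀ j, k - m ≤ j → j ≤ k → ‖f j‖ ≤ M) :
    ‖∑ j ∈ aaWindow m k, α j • f j‖ ≤ (m + 1) * C₀ * M := by
  calc ‖∑ j ∈ aaWindow m k, α j • f j‖ ≤ ∑ j ∈ aaWindow m k, C₀ * M := by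
        apply norm_sum_le_of_le
        intro j hj
        rw [norm_smul, Real.norm_eq_abs]
        have h := mem_aaWindow.1 hj
        exact mul_le_mul (hα.2 j hj) (hf j h.1 h.2) (norm_nonneg _) hC
    _ = (aaWindow m k).card * (C₀ * M) := by rw [Finset.sum_const, nsmul_eq_mul]
    _ ≤ (m + 1) * (C₀ * M) := by
        gcongr
        exact_mod_cast card_aaWindow_le m k
    _ = _ := by ring

lemma sum_single_smul {E : Type*} [AddCommGroup E] [Module ℝ E] {s : Finset ℕ} {k : ℕ}
    (hk : k ∈ s) (a : ℝ) (f : ℕ → E) :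
    ∑ j ∈ s, (Pi.single k a : ℕ → ℝ) j • f j = a • f k := by
  rw [Finset.sum_eq_single_of_mem k hk, Pi.single_eq_same]
  intro j _ hj
  rw [Pi.single_eq_of_ne hj, zero_smul]

variable {n : ℕ} {q : EuclideanSpace ℝ (Fin n) → EuclideanSpace ℝ (Fin n)}
  {xs : EuclideanSpace ℝ (Fin n)} {W : EuclideanSpace ℝ (Fin n) →L[ℝ] EuclideanSpace ℝ (Fin n)}
  {m k : ℕ} {C₀ : ℝ} {x : ℕ → EuclideanSpace ℝ (Fin n)} {α : ℕ → ℝ}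

lemma combination_sub_eq (hα : α ∈ aaFeasible m C₀ k)
    (hx : x (k + 1) = ∑ j ∈ aaWindow m k, α j • q (x j)) :
    x (k + 1) - xs = ∑ j ∈ aaWindow m k, α j • (q (x j) - xs) := by
  simp_rw [smul_sub]
  rw [Finset.sum_sub_distrib, ← Finset.sum_smul, hα.1, one_smul, hx]

/-- The new residual is `W` applied to the combined residual, up to linearization errors. -/
lemma residual_succ_sub_eq (hα : α ∈ aaFeasible m C₀ k)
    (hx : x (k + 1) = ∑ j ∈ aaWindow m k, α j • q (x j)) :
    (q (x (k + 1)) - x (k + 1)) - W (∑ j ∈ aaWindow m k, α j • (q (x j) - x j)) =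
      (q (x (k + 1)) - xs - W (x (k + 1) - xs)) -
        ∑ j ∈ aaWindow m k, α j • (q (x j) - xs - W (x j - xs)) := by
  have h1 : ∑ j ∈ aaWindow m k, α j • (q (x j) - xs - W (x j - xs)) =
      (x (k + 1) - xs) - W (∑ j ∈ aaWindow m k, α j • (x j - xs)) := by
    rw [combination_sub_eq hα hx, map_sum, ← Finset.sum_sub_distrib]
    refine Finset.sum_congr rfl fun j _ => ?_
    rw [smul_sub, map_smul]
  have h2 : ∑ j ∈ aaWindow m k, α j • (q (x j) - x j) =
      (x (k + 1) - xs) - ∑ j ∈ aaWindow m k, α j • (x j - xs) := by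
    rw [combination_sub_eq hα hx, ← Finset.sum_sub_distrib]
    refine Finset.sum_congr rfl fun j _ => ?_
    rw [← smul_sub]
    congr 1
    abel
  rw [h1, h2, map_sub]
  abel

lemma norm_residual_succ_sub_le {T : ℝ} (hT : 0 ≤ T) (hC : 0 ≤ C₀) (hα : α ∈ aaFeasible m C₀ k)
    (hx : x (k + 1) = ∑ j ∈ aaWindow m k, α j • q (x j))
    (hrem : ∀ j, k - m ≤ j → j ≤ k + 1 → ‖q (x j) - xs - W (x j - xs)‖ ≤ T) :
    ‖(q (x (k + 1)) - x (k + 1)) - W (∑ j ∈ aaWindow m k, α j • (q (x j) - x j))‖ ≤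
      ((m + 1) * C₀ + 1) * T := by
  rw [residual_succ_sub_eq (xs := xs) hα hx]
  have h1 := hrem (k + 1) (by omega) le_rfl
  have h2 := norm_sum_smul_le hT hC hα
    (f := fun j => q (x j) - xs - W (x j - xs)) fun j h h' => hrem j h (by omega)
  refine (norm_sub_le _ _).trans ?_
  linarith

/-- The combined residual satisfies the variational inequality against the newest residual. -/
lemma inner_combined_residual_nonneg (hC : 1 ≤ C₀) (hα : α ∈ aaFeasible m C₀ k)
    (hmin : IsMinOn (aaObjective q m x k) (aaFeasible m C₀ k) α) :
    0 ≤ inner ℝ (∑ j ∈ aaWindow m k, α j • (q (x j) - x j))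
      ((q (x k) - x k) - ∑ j ∈ aaWindow m k, α j • (q (x j) - x j)) := by
  have hk : k ∈ aaWindow m k := mem_aaWindow.2 ⟨by omega, le_rfl⟩
  apply inner_sub_nonneg_of_forall_norm_le
  intro t ht0 ht1
  -- Stated for general `E` to serve both the coefficient sum (`E = ℝ`) and the residuals.
  have hsum : ∀ {E : Type} [AddCommGroup E] [Module ℝ E] (f : ℕ → E),
      ∑ j ∈ aaWindow m k, ((1 - t) * α j + (Pi.single k t : ℕ → ℝ) j) • f j =
        (1 - t) • (∑ j ∈ aaWindow m k, α j • f j) + t • f k := by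
    intro E _ _ f
    simp_rw [add_smul, mul_smul]
    rw [Finset.sum_add_distrib, sum_single_smul hk, ← Finset.smul_sum]
  have hfeas : (fun j => (1 - t) * α j + (Pi.single k t : ℕ → ℝ) j) ∈ aaFeasible m C₀ k := by
    constructor
    · have := hsum (fun _ => (1 : ℝ))
      simp only [smul_eq_mul, mul_one] at this
      rw [this, hα.1]
      ring
    · intro j hj
      have h1 : |(Pi.single k t : ℕ → ℝ) j| ≤ t := by
        rcases eq_or_ne j k with rfl | hjk
        · rw [Pi.single_eq_same, abs_of_nonneg ht0]
        · rw [Pi.single_eq_of_ne hjk, abs_zero]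
          exact ht0
      calc |(1 - t) * α j + (Pi.single k t : ℕ → ℝ) j|
          ≤ |(1 - t) * α j| + |(Pi.single k t : ℕ → ℝ) j| := abs_add_le _ _
        _ ≤ (1 - t) * C₀ + t * C₀ := by
          apply add_le_add
          · rw [abs_mul, abs_of_nonneg (by linarith)]
            exact mul_le_mul_of_nonneg_left (hα.2 j hj) (by linarith)
          · exact h1.trans (le_mul_of_one_le_right ht0 hC)
        _ = C₀ := by ring
  have h := isMinOn_iff.1 hmin _ hfeas
  rw [aaObjective, aaObjective, hsum] at h
  refine h.trans_eq (congrArg _ ?_)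
  module

/-- The competitor is supported on the two newest indices, both in the window since `m ≥ 1`. -/
lemma aaObjective_le_of_consecutive {γ : ℝ} (hm : 1 ≤ m) (hγ : |1 - γ| ≤ C₀) (hγ' : |γ| ≤ C₀)
    (hmin : IsMinOn (aaObjective q m x (k + 1)) (aaFeasible m C₀ (k + 1)) α) :
    aaObjective q m x (k + 1) α ≤
      ‖(1 - γ) • (q (x k) - x k) + γ • (q (x (k + 1)) - x (k + 1))‖ := by
  have hk : k ∈ aaWindow m (k + 1) := mem_aaWindow.2 ⟨by omega, by omega⟩
  have hk1 : k + 1 ∈ aaWindow m (k + 1) := mem_aaWindow.2 ⟨by omega, le_rfl⟩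
  have hsum : ∀ {E : Type} [AddCommGroup E] [Module ℝ E] (f : ℕ → E),
      ∑ j ∈ aaWindow m (k + 1),
        ((Pi.single k (1 - γ) : ℕ → ℝ) j + (Pi.single (k + 1) γ : ℕ → ℝ) j) • f j =
        (1 - γ) • f k + γ • f (k + 1) := by
    intro E _ _ f
    simp_rw [add_smul]
    rw [Finset.sum_add_distrib, sum_single_smul hk, sum_single_smul hk1]
  have hfeas : (fun j => (Pi.single k (1 - γ) : ℕ → ℝ) j + (Pi.single (k + 1) γ : ℕ → ℝ) j) ∈
      aaFeasible m C₀ (k + 1) := by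
    constructor
    · have := hsum (fun _ => (1 : ℝ))
      simp only [smul_eq_mul, mul_one] at this
      rw [this]
      ring
    · intro j _
      change |(Pi.single k (1 - γ) : ℕ → ℝ) j + (Pi.single (k + 1) γ : ℕ → ℝ) j| ≤ C₀
      rcases eq_or_ne j k with rfl | hjk
      · rwa [Pi.single_eq_same, Pi.single_eq_of_ne (by omega), add_zero]
      · rw [Pi.single_eq_of_ne hjk, zero_add]
        rcases eq_or_ne j (k + 1) with rfl | hjk1
        · rwa [Pi.single_eq_same]
        · rw [Pi.single_eq_of_ne hjk1, abs_zero]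
          exact (abs_nonneg _).trans hγ'
  have h := isMinOn_iff.1 hmin _ hfeas
  rwa [aaObjective, aaObjective, hsum] at h

/-- The core estimate. The bound on `C₀` makes the weights `1 - γ` and `γ` of the geometric argument
admissible. -/
lemma norm_residual_add_two_le {c d ω T : ℝ} (hd : 0 ≤ d) (hcd : |c| + d ≤ ‖W‖) (hW : ‖W‖ < 1)
    (hω : ∀ a : ℝ, 0 ≤ a → Real.sin (perturbAngle c d a + shiftAngle c a) ≤ ω)
    (hWc : ∀ v, ‖W v - c • v‖ ≤ d * ‖v‖) (hm : 1 ≤ m) (hC : 1 + (1 - ‖W‖)⁻¹ ≤ C₀)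
    (hx : IsModifiedAA q m C₀ x) (hk : 1 ≤ k) (hT : 0 ≤ T)
    (hrem : ∀ j, k - m ≤ j → j ≤ k + 2 → ‖q (x j) - xs - W (x j - xs)‖ ≤ T) :
    ‖q (x (k + 2)) - x (k + 2)‖ ≤
      ω * ‖W‖ * ‖q (x k) - x k‖ + C₀ * (((m + 1) * C₀ + 1) * T) := by
  have hW' : 0 < 1 - ‖W‖ := by linarith
  have hinv : 0 < (1 - ‖W‖)⁻¹ := by positivity
  have hC1 : 1 ≤ C₀ := by linarith
  obtain ⟨α, hα, hmin, hxk⟩ := hx.step k hk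
  obtain ⟨β, hβ, hmin', hxk'⟩ := hx.step (k + 1) (by omega)
  have e1 := norm_residual_succ_sub_le (xs := xs) (W := W) hT (by linarith) hα hxk
    fun j h h' => hrem j h (by omega)
  have e2 := norm_residual_succ_sub_le (xs := xs) (W := W) hT (by linarith) hβ hxk'
    fun j h h' => hrem j (by omega) (by omega)
  set g := ∑ j ∈ aaWindow m k, α j • (q (x j) - x j)
  set r := q (x k) - x k
  set r' := q (x (k + 1)) - x (k + 1)
  obtain ⟨γ, hγ, hγr⟩ := exists_norm_combination_le hd (hcd.trans_lt hW) hω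
    (inner_combined_residual_nonneg hC1 hα hmin) (hWc g)
  have hγ1 : |γ| ≤ (1 - ‖W‖)⁻¹ := hγ.trans (inv_anti₀ hW' (by linarith))
  have hγ2 : |1 - γ| ≤ C₀ := by
    refine (abs_sub 1 γ).trans ?_
    rw [abs_one]
    linarith
  have hobj := aaObjective_le_of_consecutive hm hγ2 (by linarith) hmin'
  set D := ((m + 1) * C₀ + 1) * T
  have hD : 0 ≤ D := (norm_nonneg _).trans e1
  have h1 : ‖(1 - γ) • r + γ • r'‖ ≤ ω * ‖r‖ + (1 - ‖W‖)⁻¹ * D := by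
    calc ‖(1 - γ) • r + γ • r'‖ = ‖((1 - γ) • r + γ • W g) + γ • (r' - W g)‖ := by
          congr 1
          module
      _ ≤ ω * ‖r‖ + |γ| * ‖r' - W g‖ := by
          refine (norm_add_le _ _).trans (add_le_add hγr ?_)
          rw [norm_smul, Real.norm_eq_abs]
      _ ≤ _ := by gcongr
  have h2 := W.le_opNorm (∑ j ∈ aaWindow m (k + 1), β j • (q (x j) - x j))
  have h3 : ‖∑ j ∈ aaWindow m (k + 1), β j • (q (x j) - x j)‖ ≤
      ω * ‖r‖ + (1 - ‖W‖)⁻¹ * D := hobj.trans h1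
  calc ‖q (x (k + 2)) - x (k + 2)‖
      ≤ ‖W‖ * (ω * ‖r‖ + (1 - ‖W‖)⁻¹ * D) + D := by
        have h4 := norm_le_norm_add_norm_sub' (q (x (k + 2)) - x (k + 2))
          (W (∑ j ∈ aaWindow m (k + 1), β j • (q (x j) - x j)))
        have h5 := mul_le_mul_of_nonneg_left h3 (norm_nonneg W)
        exact h4.trans (add_le_add (h2.trans h5) e2)
    _ = ω * ‖W‖ * ‖r‖ + (‖W‖ * (1 - ‖W‖)⁻¹ + 1) * D := by ring
    _ ≤ ω * ‖W‖ * ‖r‖ + C₀ * D := by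
        gcongr
        have : ‖W‖ * (1 - ‖W‖)⁻¹ ≤ (1 - ‖W‖)⁻¹ := mul_le_of_le_one_left hinv.le hW.le
        linarith

lemma norm_sub_fixed_le {M : ℝ} (hM : 0 ≤ M) (hC : 0 ≤ C₀) (hx : IsModifiedAA q m C₀ x)
    (hk : 1 ≤ k) (h : ∀ j, k - m ≤ j → j ≤ k → ‖q (x j) - xs‖ ≤ M) :
    ‖x (k + 1) - xs‖ ≤ (m + 1) * C₀ * M := by
  obtain ⟨α, hα, -, hxk⟩ := hx.step k hk
  rw [combination_sub_eq hα hxk]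
  exact norm_sum_smul_le hM hC hα h

end Anderson

/-! ### From the recurrence to local convergence -/

section LocalConvergence

variable {n : ℕ} {q : EuclideanSpace ℝ (Fin n) → EuclideanSpace ℝ (Fin n)}
  {xs : EuclideanSpace ℝ (Fin n)} {W : EuclideanSpace ℝ (Fin n) →L[ℝ] EuclideanSpace ℝ (Fin n)}
  {m k : ℕ} {C₀ : ℝ} {x : ℕ → EuclideanSpace ℝ (Fin n)}

/-- Near the fixed point `q` is a contraction and the residual is comparable to the error. -/
lemma residual_bounds {ε : ℝ} {y : EuclideanSpace ℝ (Fin n)} (hε : ε ≤ (1 - ‖W‖) / 2)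
    (h : ‖q y - xs - W (y - xs)‖ ≤ ε * ‖y - xs‖) :
    ‖q y - xs‖ ≤ (1 + ‖W‖) / 2 * ‖y - xs‖ ∧ (1 - ‖W‖) / 2 * ‖y - xs‖ ≤ ‖q y - y‖ ∧
      ‖q y - y‖ ≤ (1 + (1 + ‖W‖) / 2) * ‖y - xs‖ := by
  have h1 : ‖q y - xs‖ ≤ (1 + ‖W‖) / 2 * ‖y - xs‖ := by
    have h2 := norm_le_norm_add_norm_sub' (q y - xs) (W (y - xs))
    have h3 := W.le_opNorm (y - xs)
    have h4 := mul_le_mul_of_nonneg_right hε (norm_nonneg (y - xs))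
    linarith
  have e : q y - y = (q y - xs) - (y - xs) := by abel
  refine ⟨h1, ?_, ?_⟩
  · have := norm_sub_norm_le (y - xs) (q y - xs)
    rw [norm_sub_rev (y - xs) (q y - xs), ← e] at this
    linarith
  · have := norm_sub_le (q y - xs) (y - xs)
    rw [← e] at this
    linarith

/-- A step enlarges errors at most by `(m + 1) * C₀`, so a window within `r` divided by this factor
keeps `x (k + 2)` within `r`. Errors are then converted to residuals, making the remainder a
multiple of `ε * M`. -/
lemma residual_recurrence {c d ω ε r : ℝ} (hd : 0 ≤ d) (hcd : |c| + d ≤ ‖W‖) (hW : ‖W‖ < 1)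
    (hω : ∀ a : ℝ, 0 ≤ a → Real.sin (perturbAngle c d a + shiftAngle c a) ≤ ω)
    (hWc : ∀ v, ‖W v - c • v‖ ≤ d * ‖v‖) (hm : 1 ≤ m) (hC : 1 + (1 - ‖W‖)⁻¹ ≤ C₀)
    (hx : IsModifiedAA q m C₀ x) (hk : m + 1 ≤ k) (hε0 : 0 ≤ ε) (hε : ε ≤ (1 - ‖W‖) / 2)
    (hrem : ∀ y, ‖y - xs‖ ≤ r → ‖q y - xs - W (y - xs)‖ ≤ ε * ‖y - xs‖)
    (hball : ∀ j, k - m ≤ j → j ≤ k + 1 → ‖x j - xs‖ ≤ r / ((m + 1) * C₀)) :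
    ‖x (k + 2) - xs‖ ≤ r ∧
      ∀ M, (∀ j, k - m ≤ j → j ≤ k + 1 → ‖q (x j) - x j‖ ≤ M) →
        ‖q (x (k + 2)) - x (k + 2)‖ ≤ ω * ‖W‖ * ‖q (x k) - x k‖ +
          C₀ * ((m + 1) * C₀ + 1) * ((m + 1) * C₀) / ((1 - ‖W‖) / 2) * ε * M := by
  have hν : 0 < (1 - ‖W‖) / 2 := by linarith
  have hC1 : 1 ≤ C₀ := by
    have : 0 < (1 - ‖W‖)⁻¹ := inv_pos.2 (by linarith)
    linarith
  have hG : 1 ≤ (m + 1) * C₀ := by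
    have : (0 : ℝ) ≤ m := m.cast_nonneg
    nlinarith
  set G := (m + 1) * C₀ with hG_def
  have hr : 0 ≤ r / G := (norm_nonneg _).trans (hball k (by omega) (by omega))
  have hr0 : 0 ≤ r := by
    have := mul_nonneg hr (by linarith : 0 ≤ G)
    rwa [div_mul_cancel₀ _ (by linarith)] at this
  have hball' : ∀ j, k - m ≤ j → j ≤ k + 1 → ‖x j - xs‖ ≤ r := fun j h h' =>
    (hball j h h').trans (div_le_self hr0 hG)
  have hle : ∀ j, k - m ≤ j → j ≤ k + 1 → ‖q (x j) - xs‖ ≤ ‖x j - xs‖ := fun j h h' =>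
    (residual_bounds hε (hrem _ (hball' j h h'))).1.trans
      (mul_le_of_le_one_left (norm_nonneg _) (by linarith))
  have hnext : ∀ L, 0 ≤ L → (∀ j, k - m ≤ j → j ≤ k + 1 → ‖x j - xs‖ ≤ L) →
      ‖x (k + 2) - xs‖ ≤ G * L := fun L hL h =>
    norm_sub_fixed_le hL (by linarith) hx (by omega)
      fun j h1 h2 => (hle j (by omega) h2).trans (h j (by omega) h2)
  have hlast : ‖x (k + 2) - xs‖ ≤ r := by
    have := hnext _ hr hball
    rwa [mul_div_cancel₀ _ (by linarith)] at this
  refine ⟨hlast, fun M hM => ?_⟩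
  have hM0 : 0 ≤ M := (norm_nonneg _).trans (hM k (by omega) (by omega))
  have herr : ∀ j, k - m ≤ j → j ≤ k + 1 → ‖x j - xs‖ ≤ M / ((1 - ‖W‖) / 2) := by
    intro j h h'
    rw [le_div_iff₀ hν, mul_comm]
    exact (residual_bounds hε (hrem _ (hball' j h h'))).2.1.trans (hM j h h')
  have hL0 : 0 ≤ M / ((1 - ‖W‖) / 2) := by positivity
  have hT : ∀ j, k - m ≤ j → j ≤ k + 2 →
      ‖q (x j) - xs - W (x j - xs)‖ ≤ ε * (G * (M / ((1 - ‖W‖) / 2))) := by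
    intro j h h'
    rcases Nat.lt_or_ge (k + 1) j with hj | hj
    · obtain rfl : j = k + 2 := by omega
      exact (hrem _ hlast).trans (mul_le_mul_of_nonneg_left (hnext _ hL0 herr) hε0)
    · refine (hrem _ (hball' j h hj)).trans (mul_le_mul_of_nonneg_left ?_ hε0)
      exact (herr j h hj).trans (le_mul_of_one_le_left hL0 hG)
  refine (norm_residual_add_two_le hd hcd hW hω hWc hm hC hx (by omega) (by positivity)
    hT).trans_eq ?_
  rw [← hG_def]
  ring

/-- The starting phase, in which the window may contain the uncontrolled point `x 0`. -/
lemma norm_initial_le {ε r δ : ℝ} (hW : ‖W‖ < 1) (hG : 1 ≤ (m + 1) * C₀)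
    (hC : 0 ≤ C₀) (hx : IsModifiedAA q m C₀ x) (hε : ε ≤ (1 - ‖W‖) / 2)
    (hrem : ∀ y, ‖y - xs‖ ≤ r → ‖q y - xs - W (y - xs)‖ ≤ ε * ‖y - xs‖)
    (hx1 : ‖x 1 - xs‖ ≤ δ) {N : ℕ} (hδ : ((m + 1) * C₀) ^ N * δ ≤ r) :
    ∀ j, 1 ≤ j → j ≤ N → ‖x j - xs‖ ≤ ((m + 1) * C₀) ^ j * δ := by
  have hδ0 : 0 ≤ δ := (norm_nonneg _).trans hx1
  intro j
  induction j using Nat.strong_induction_on with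
  | _ j ih =>
    intro h1 hN
    rcases h1.eq_or_lt with rfl | h2
    · rw [pow_one]
      exact hx1.trans (le_mul_of_one_le_left hδ0 hG)
    obtain ⟨k, rfl⟩ : ∃ k, j = k + 1 := ⟨j - 1, by omega⟩
    rw [pow_succ', mul_assoc]
    refine norm_sub_fixed_le (by positivity) hC hx (by omega) fun i _ hi => ?_
    rcases Nat.eq_zero_or_pos i with rfl | hi0
    · rw [← hx.first]
      exact hx1.trans (le_mul_of_one_le_left hδ0 (one_le_pow₀ hG))
    · have h3 := ih i (by omega) hi0 (by omega)
      have h4 : ‖x i - xs‖ ≤ r := h3.trans (le_trans (by gcongr; omega) hδ)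
      refine ((residual_bounds hε (hrem _ h4)).1.trans
        (mul_le_of_le_one_left (norm_nonneg _) (by linarith))).trans (h3.trans ?_)
      gcongr

lemma exists_linearization_radius (hfix : q xs = xs) (hq : HasFDerivAt q W xs) {ε : ℝ}
    (hε : 0 < ε) :
    ∃ r > 0, ∀ y, ‖y - xs‖ ≤ r → ‖q y - xs - W (y - xs)‖ ≤ ε * ‖y - xs‖ := by
  have h := hq.isLittleO.bound hε
  rw [hfix] at h
  obtain ⟨r, hr, h⟩ := Metric.nhds_basis_closedBall.eventually_iff.1 h
  refine ⟨r, hr, fun y hy => h ?_⟩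
  rwa [Metric.mem_closedBall, dist_eq_norm]

lemma exists_perturbation_size {ρ θ ν L : ℝ} (hθ : 0 < θ) (hρ : ρ < θ ^ 2) (hν : 0 < ν)
    (hL : 0 < L) (m : ℕ) : ∃ ε > 0, ε ≤ ν ∧ ρ + L * ε / θ ^ m ≤ θ ^ 2 := by
  have h0 : 0 < θ ^ 2 - ρ := by linarith
  refine ⟨min ν ((θ ^ 2 - ρ) * θ ^ m / L), by positivity, min_le_left _ _, ?_⟩
  have h1 : min ν ((θ ^ 2 - ρ) * θ ^ m / L) ≤ (θ ^ 2 - ρ) * θ ^ m / L := min_le_right _ _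
  have h2 : L * min ν ((θ ^ 2 - ρ) * θ ^ m / L) / θ ^ m ≤ θ ^ 2 - ρ := by
    rw [div_le_iff₀ (by positivity), mul_comm, ← le_div_iff₀ hL]
    exact h1
  linarith

/-- Local geometric convergence at any rate `θ` with `ω * ‖W‖ < θ ^ 2`. -/
lemma exists_radius_forall_geometric {c d ω θ : ℝ} (hd : 0 ≤ d) (hcd : |c| + d ≤ ‖W‖)
    (hW : ‖W‖ < 1)
    (hω : ∀ a : ℝ, 0 ≤ a → Real.sin (perturbAngle c d a + shiftAngle c a) ≤ ω) (hω0 : 0 ≤ ω)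
    (hWc : ∀ v, ‖W v - c • v‖ ≤ d * ‖v‖) (hfix : q xs = xs) (hq : HasFDerivAt q W xs)
    (hm : 1 ≤ m) (hC : 1 + (1 - ‖W‖)⁻¹ ≤ C₀) (hθ0 : 0 < θ) (hθ1 : θ ≤ 1)
    (hθ : ω * ‖W‖ < θ ^ 2) :
    ∃ δ > 0, ∀ x, IsModifiedAA q m C₀ x → ‖x 1 - xs‖ < δ →
      ∃ B, ∀ j, 1 ≤ j → ‖x j - xs‖ ≤ B * θ ^ j := by
  have hν : 0 < (1 - ‖W‖) / 2 := by linarith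
  have hC1 : 1 ≤ C₀ := by
    have : 0 < (1 - ‖W‖)⁻¹ := inv_pos.2 (by linarith)
    linarith
  have hG : 1 ≤ (m + 1) * C₀ := by
    have : (0 : ℝ) ≤ m := m.cast_nonneg
    nlinarith
  obtain ⟨ε, hε0, hε, hεθ⟩ := exists_perturbation_size hθ0 hθ hν
    (L := C₀ * ((m + 1) * C₀ + 1) * ((m + 1) * C₀) / ((1 - ‖W‖) / 2)) (by positivity) m
  obtain ⟨r, hr, hrem⟩ := exists_linearization_radius hfix hq hε0
  have hrec := fun x k hx hk =>
    residual_recurrence (q := q) (x := x) (k := k) hd hcd hW hω hWc hm hC hx hk hε0.le hε hrem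
  set L := C₀ * ((m + 1) * C₀ + 1) * ((m + 1) * C₀) / ((1 - ‖W‖) / 2)
  have hinit := fun x hx δ hx1 => norm_initial_le (q := q) (x := x) (δ := δ) hW hG (by linarith)
    hx hε hrem hx1 (N := m + 2)
  set G := (m + 1) * C₀
  have hG0 : 0 < G := by linarith
  -- Chosen so that a residual of size at most `C` forces an error of at most `r / G`.
  set C := (1 - ‖W‖) / 2 * (r / G) with hC_def
  have hC0 : 0 < C := by positivity
  have hCr : C ≤ r / 2 := by
    have h1 : r / G ≤ r := div_le_self hr.le hG
    have h2 : (1 - ‖W‖) / 2 ≤ 1 / 2 := by linarith [norm_nonneg W]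
    calc C ≤ 1 / 2 * r := by rw [hC_def]; gcongr
      _ = r / 2 := by ring
  -- `G ^ (m + 2)` absorbs the growth of the starting phase; the `2` absorbs the passage from errors
  -- to residuals.
  refine ⟨C * θ ^ (m + 2) / 2 / G ^ (m + 2), by positivity, fun x hx hx1 => ?_⟩
  set δ := C * θ ^ (m + 2) / 2 / G ^ (m + 2) with hδ_def
  have hδ : G ^ (m + 2) * δ = C * θ ^ (m + 2) / 2 := by
    rw [hδ_def, mul_div_cancel₀ _ (by positivity)]
  have hδ0 : 0 < δ := by positivity
  have hCθ : C * θ ^ (m + 2) ≤ C := mul_le_of_le_one_right hC0.le (pow_le_one₀ hθ0.le hθ1)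
  have hstart : ∀ j, 1 ≤ j → j ≤ m + 2 → ‖x j - xs‖ ≤ C * θ ^ (m + 2) / 2 := by
    intro j h1 h2
    rw [← hδ]
    refine (hinit x hx δ hx1.le (by rw [hδ]; linarith) j h1 h2).trans ?_
    gcongr
  -- With `N = 1` no window reaches `x 0`, where the linearization is not controlled.
  have key := geometric_bound_of_recurrence (R := fun j => ‖q (x j) - x j‖)
    (A := fun j => ‖x j - xs‖ ≤ r) (N := 1) (m := m) (C := C) hθ0 hθ1 hC0.le
    (by positivity : 0 ≤ ω * ‖W‖) ?_ ?_ hεθ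
  · refine ⟨C / ((1 - ‖W‖) / 2), fun j hj => ?_⟩
    obtain ⟨h1, h2⟩ := key j hj
    have h3 := (residual_bounds hε (hrem _ h1)).2.1.trans h2
    rw [div_mul_eq_mul_div, le_div_iff₀ hν, mul_comm]
    exact h3
  · intro j h1 h2
    have h3 := hstart j h1 (by omega)
    have h4 : ‖x j - xs‖ ≤ r := by linarith
    refine ⟨h4, (residual_bounds hε (hrem _ h4)).2.2.trans ?_⟩
    calc (1 + (1 + ‖W‖) / 2) * ‖x j - xs‖ ≤ 2 * (C * θ ^ (m + 2) / 2) := by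
          gcongr
          linarith
      _ = C * θ ^ (m + 2) := by ring
      _ ≤ C * θ ^ j := mul_le_mul_of_nonneg_left
          (pow_le_pow_of_le_one hθ0.le hθ1 (by omega)) hC0.le
  · intro k hk hprev
    refine hrec x k hx (by omega) fun j h1 h2 => ?_
    obtain ⟨h3, h4⟩ := hprev j (by omega) h2
    have h5 := (residual_bounds hε (hrem _ h3)).2.1.trans
      (h4.trans (mul_le_of_le_one_right hC0.le (pow_le_one₀ hθ0.le hθ1)))
    rw [hC_def] at h5
    exact le_of_mul_le_mul_left h5 hν

/-- A convergent sequence eventually contracts at any rate `θ` with `ω * ‖W‖ < θ ^ 2`. -/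
lemma exists_eventually_geometric {c d ω θ : ℝ} (hd : 0 ≤ d) (hcd : |c| + d ≤ ‖W‖)
    (hW : ‖W‖ < 1)
    (hω : ∀ a : ℝ, 0 ≤ a → Real.sin (perturbAngle c d a + shiftAngle c a) ≤ ω) (hω0 : 0 ≤ ω)
    (hWc : ∀ v, ‖W v - c • v‖ ≤ d * ‖v‖) (hfix : q xs = xs) (hq : HasFDerivAt q W xs)
    (hm : 1 ≤ m) (hC : 1 + (1 - ‖W‖)⁻¹ ≤ C₀) (hx : IsModifiedAA q m C₀ x)
    (hlim : Tendsto x atTop (𝓝 xs)) (hθ0 : 0 < θ) (hθ1 : θ ≤ 1) (hθ : ω * ‖W‖ < θ ^ 2) :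
    ∃ B, ∀ᶠ j in atTop, ‖x j - xs‖ ≤ B * θ ^ j := by
  have hν : 0 < (1 - ‖W‖) / 2 := by linarith
  have hC1 : 1 ≤ C₀ := by
    have : 0 < (1 - ‖W‖)⁻¹ := inv_pos.2 (by linarith)
    linarith
  obtain ⟨ε, hε0, hε, hεθ⟩ := exists_perturbation_size hθ0 hθ hν
    (L := C₀ * ((m + 1) * C₀ + 1) * ((m + 1) * C₀) / ((1 - ‖W‖) / 2)) (by positivity) m
  obtain ⟨r, hr, hrem⟩ := exists_linearization_radius hfix hq hε0
  have hev : ∀ᶠ j in atTop, ‖x j - xs‖ < min r (r / ((m + 1) * C₀)) :=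
    (tendsto_iff_norm_sub_tendsto_zero.1 hlim).eventually_lt_const (by positivity)
  obtain ⟨N₀, hN₀⟩ := eventually_atTop.1 hev
  set N := N₀ + 1
  have hball : ∀ j, N ≤ j → ‖x j - xs‖ ≤ r ∧ ‖x j - xs‖ ≤ r / ((m + 1) * C₀) :=
    fun j hj => ⟨(hN₀ j (by omega)).le.trans (min_le_left _ _),
      (hN₀ j (by omega)).le.trans (min_le_right _ _)⟩
  -- A crude constant dominating the finitely many base cases.
  set C := ∑ j ∈ Finset.range (N + m + 2), ‖q (x j) - x j‖ / θ ^ j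
  have hC0 : 0 ≤ C := Finset.sum_nonneg fun j _ => by positivity
  have key := geometric_bound_of_recurrence (R := fun j => ‖q (x j) - x j‖)
    (A := fun _ => True) (N := N) (m := m) (C := C) hθ0 hθ1 hC0
    (by positivity : 0 ≤ ω * ‖W‖) ?_ ?_ hεθ
  · refine ⟨C / ((1 - ‖W‖) / 2), eventually_atTop.2 ⟨N, fun j hj => ?_⟩⟩
    have h3 := (residual_bounds hε (hrem _ (hball j hj).1)).2.1.trans (key j hj).2
    rw [div_mul_eq_mul_div, le_div_iff₀ hν, mul_comm]
    exact h3
  · intro j _ h2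
    refine ⟨trivial, ?_⟩
    rw [← div_le_iff₀ (by positivity)]
    exact Finset.single_le_sum (f := fun j => ‖q (x j) - x j‖ / θ ^ j)
      (fun i _ => by positivity) (Finset.mem_range.2 (by omega))
  · intro k hk _
    refine ⟨trivial, (residual_recurrence hd hcd hW hω hWc hm hC hx (by omega) hε0.le hε hrem
      fun j h1 h2 => (hball j (by omega)).2).2⟩

end LocalConvergence

/-! ### The main theorem -/

theorem theorem2 (n : ℕ) (q : EuclideanSpace ℝ (Fin n) → EuclideanSpace ℝ (Fin n))
    (xs : EuclideanSpace ℝ (Fin n)) (hfix : q xs = xs)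
    (W : EuclideanSpace ℝ (Fin n) →L[ℝ] EuclideanSpace ℝ (Fin n))
    (hW : HasFDerivAt q W xs)
    (hsymm : (W : EuclideanSpace ℝ (Fin n) →ₗ[ℝ] EuclideanSpace ℝ (Fin n)).IsSymmetric)
    (hnorm : ‖W‖ < 1)
    (hne : lambdaMax W ≠ -lambdaMin W) :
    w0 W < ‖W‖ ∧
    ∃ C₀' : ℝ, ∀ m : ℕ, 1 ≤ m → ∀ C₀ : ℝ, C₀' < C₀ →
      ∃ δ : ℝ, 0 < δ ∧ ∀ x : ℕ → EuclideanSpace ℝ (Fin n),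
        IsModifiedAA q m C₀ x → ‖x 1 - xs‖ < δ →
          Tendsto x atTop (𝓝 xs) ∧
          rLinearFactor x xs ≤ Real.sqrt (w0 W * ‖W‖) := by
  -- In dimension `0` both extreme eigenvalues default to `0`, contradicting `hne`.
  have : NeZero n := by
    refine ⟨?_⟩
    rintro rfl
    have h : ∀ μ : ℝ, ¬ Module.End.HasEigenvalue (W : EuclideanSpace ℝ (Fin 0) →ₗ[ℝ] _) μ := by
      intro μ hμ
      obtain ⟨v, hv⟩ := hμ.exists_hasEigenvector
      exact hv.2 (Subsingleton.elim v 0)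
    apply hne
    simp [lambdaMax, lambdaMin, h]
  have hlt := w0_lt_norm hsymm hnorm hne
  refine ⟨hlt, 1 + (1 - ‖W‖)⁻¹, fun m hm C₀ hC => ?_⟩
  have hω0 := w0_nonneg hsymm
  have hd : 0 ≤ (lambdaMax W - lambdaMin W) / 2 := by
    linarith [lambdaMin_le_lambdaMax hsymm]
  have hcd := abs_center_add_halfWidth_le_norm hsymm
  have hω := fun a (ha : 0 ≤ a) => sin_le_w0 hsymm ha
  have hWc := norm_apply_sub_center_smul_le hsymm
  have hρ0 : 0 ≤ w0 W * ‖W‖ := by positivity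
  have hρ1 : Real.sqrt (w0 W * ‖W‖) < 1 := by
    rw [Real.sqrt_lt' one_pos]
    nlinarith [norm_nonneg W]
  -- This single `θ` fixes `δ` and gives convergence only. The sharp rate comes afterwards from the
  -- tail, with `δ` independent of `t`.
  obtain ⟨θ, hθ, hθ1⟩ := exists_between hρ1
  have hθ0 : 0 < θ := (Real.sqrt_nonneg _).trans_lt hθ
  obtain ⟨δ, hδ, hgeo⟩ := exists_radius_forall_geometric hd hcd hnorm hω hω0 hWc hfix hW hm hC.le
    hθ0 hθ1.le ((Real.sqrt_lt' hθ0).1 hθ)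
  refine ⟨δ, hδ, fun x hx hx1 => ?_⟩
  obtain ⟨B, hB⟩ := hgeo x hx hx1
  have hlim : Tendsto x atTop (𝓝 xs) := by
    rw [tendsto_iff_norm_sub_tendsto_zero]
    have h0 : Tendsto (fun j : ℕ => B * θ ^ j) atTop (𝓝 0) := by
      simpa using (tendsto_pow_atTop_nhds_zero_of_lt_one hθ0.le hθ1).const_mul B
    exact squeeze_zero' (Eventually.of_forall fun _ => norm_nonneg _)
      (eventually_atTop.2 ⟨1, hB⟩) h0
  refine ⟨hlim, le_of_forall_gt_imp_ge_of_dense fun t ht => ?_⟩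
  have hs : Real.sqrt (w0 W * ‖W‖) < min t θ := lt_min ht hθ
  have hs0 : 0 < min t θ := (Real.sqrt_nonneg _).trans_lt hs
  obtain ⟨B', hB'⟩ := exists_eventually_geometric hd hcd hnorm hω hω0 hWc hfix hW hm hC.le hx hlim
    hs0 ((min_le_right _ _).trans hθ1.le) ((Real.sqrt_lt' hs0).1 hs)
  refine le_trans ?_ (min_le_left t θ)
  exact limsup_root_le_of_eventually_le (fun k => norm_nonneg _) hs0
    (hB'.mono fun j hj => by rwa [norm_sub_rev])
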